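/- The family $\mathscr H_n^4$ of $n$-dimensional (generalized) $K_4$-hypercubes is defined recursively for $n\ge 2$: the only member of $\mathscr H_2^4$, up to isomorphism, is the complete graph $K_4$; for $n\ge 3$, the members of $\mathscr H_n^4$ are, up to isomorphism, exactly the graphs obtained from two disjoint graphs in $\mathscr H_{n-1}^4$ (not necessarily isomorphic to each other) by adding an arbitrary perfect matching between their vertex sets. For a finite connected graph $G$, an $h$-extra edge-cut is a set $F\subseteq E(G)$ such that $G-F$ is disconnected and every component of $G-F$ has at least $h$ vertices; the $h$-extra edge-connectivity $\lambda_h(G)$ is the minimum size of an $h$-extra edge-cut of $G$, if one exists. For $m\le\lfloor |V(G)|/2\rfloor$, let $\xi_m(G)$ be the minimum number of edges with exactly one endpoint in $X$, over all $X\subseteq V(G)$ with $|X|=m$ such that the induced subgraphs $G[X]$ and $G[V(G)\setminus X]$ are both connected. **Theorem.** Let $n\ge 4$ be an integer, let $\gamma=0$ if $n$ is even and $\gamma=1$ if $n$ is odd, let $t$ be an integer with $0\le t\le\lfloor n/2\rfloor-1$, and let $g_t=\left\lceil 2^{2t+2+\gamma}/3\right\rceil$. Then for every graph $H_n^4\in\mathscr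 H_n^4$ and every integer $h$ with $2^{\lceil n/2\rceil+t}-g_t\le h\le 2^{\lceil n/2\rceil+t}$, $$\lambda_h(H_n^4)=\xi_{2^{\lceil n/2\rceil+t}}(H_n^4)=\left(\lfloor n/2\rfloor-t\right)2^{\lceil n/2\rceil+t}.$$ -/

import Mathlib

universe u

/-- The graph obtained from disjoint copies of `G₀` and `G₁` by adding the perfect matching
`{x, M x}`, for `x` a vertex of `G₀`, between them. -/
def matchingJoin {V₀ V₁ : Type u} (G₀ : SimpleGraph V₀) (G₁ : SimpleGraph V₁) (M : V₀ ≃ V₁) :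
    SimpleGraph (V₀ ⊕ V₁) :=
  (G₀ ⊕g G₁) ⊔
    SimpleGraph.fromRel (fun a b => ∃ x : V₀, a = Sum.inl x ∧ b = Sum.inr (M x))

/-- `IsK4Hypercube n G`: the graph `G` is an `n`-dimensional (generalized) `K₄`-hypercube. For
`n = 2` these are the graphs isomorphic to `K₄`; those of dimension `n + 1` are, up to isomorphism,
the graphs obtained from two (possibly non-isomorphic) `n`-dimensional ones by adding an arbitrary
perfect matching between them. -/
inductive IsK4Hypercube : ℕ → {V : Type u} → SimpleGraph V → Prop
  | base {V : Type u} (G : SimpleGraph V) (e : G ≃g (⊤ : SimpleGraph (Fin 4))) :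
      IsK4Hypercube 2 G
  | step {n : ℕ} {V V₀ V₁ : Type u} (G₀ : SimpleGraph V₀) (G₁ : SimpleGraph V₁)
      (h₀ : IsK4Hypercube n G₀) (h₁ : IsK4Hypercube n G₁) (M : V₀ ≃ V₁)
      (G : SimpleGraph V) (e : G ≃g matchingJoin G₀ G₁ M) :
      IsK4Hypercube (n + 1) G

/-- The set of edges of `G` with exactly one endpoint in `X`. -/
def edgeBoundary {V : Type u} (G : SimpleGraph V) (X : Set V) : Set (Sym2 V) :=
  {e | e ∈ G.edgeSet ∧ ∃ x ∈ X, ∃ y ∉ X, e = s(x, y)}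

/-- `F` is an `h`-extra edge-cut of `G`: a set of edges whose removal disconnects `G` and leaves
only components with at least `h` vertices. -/
def IsExtraEdgeCut {V : Type u} [Finite V] (G : SimpleGraph V) (h : ℕ) (F : Set (Sym2 V)) : Prop :=
  F ⊆ G.edgeSet ∧ ¬ (G.deleteEdges F).Connected ∧
    ∀ C : (G.deleteEdges F).ConnectedComponent, h ≤ C.supp.ncard

/-- The `h`-extra edge-connectivity `λ_h(G)`: the least size of an `h`-extra edge-cut of `G`
(`⊤` if there is none). -/
noncomputable def extraEdgeConnectivity {V : Type u} [Finite V] (G : SimpleGraph V) (h : ℕ) : ℕ∞ :=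
  ⨅ (F : Set (Sym2 V)) (_ : IsExtraEdgeCut G h F), F.encard

/-- `ξ_m(G)`: the least number of edges between `X` and its complement, over the sets `X` of
`m ≤ ⌊|V(G)|/2⌋` vertices such that `G[X]` and `G[Xᶜ]` are both connected
(`⊤` if there is none). -/
noncomputable def xi {V : Type u} [Finite V] (G : SimpleGraph V) (m : ℕ) : ℕ∞ :=
  ⨅ (X : Set V) (_ : X.ncard = m ∧ m ≤ Nat.card V / 2 ∧
      (G.induce X).Connected ∧ (G.induce Xᶜ).Connected), (edgeBoundary G X).encard

-- An `n`-dimensional K₄-hypercube is (n+1)-regular. Hence, if every set of m vertices has inner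
-- degree sum at most E(m) = `maxDegreeSum m`, its boundary has at least (n+1)m − E(m) edges. This
-- holds whatever the matchings are: a set with a and b vertices in the two halves has at most
-- min(a,b) matching edges inside it, and E(a) + E(b) + 2 min(a,b) ≤ E(a+b)
-- (`maxDegreeSum_superadditive`, `IsK4Hypercube.le_cutSize_add`).
--
-- Put k = ⌈n/2⌉ + t and n = k + d + 1. Some k-dimensional subcube has boundary (d+1)2^k with both
-- sides connected (`IsK4Hypercube.exists_subcube`). Conversely, an h-extra edge-cut contains the
-- boundary of a set of m vertices, h ≤ m ≤ 2^(n−1), so what remains is the numerical inequality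
-- (n+1)m − E(m) ≥ (d+1)2^k on that range (`mul_two_pow_add_maxDegreeSum_le`).

universe v

section

open Finset

/-! ### The extremal function E = `maxDegreeSum` -/

/-- The number of neighbours of the `j`-th vertex among the earlier ones, in the ordering of the
vertices of a `K₄`-hypercube which maximises the number of edges in initial segments. -/
def backDegree (j : ℕ) : ℕ :=
  if j < 4 then j else 1 + backDegree (j - 2 ^ Nat.log 2 j)
termination_by j
decreasing_by
  have : 0 < 2 ^ Nat.log 2 j := by positivity
  omega

/-- The largest degree sum of an induced subgraph on `m` vertices of a `K₄`-hypercube. -/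
def maxDegreeSum (m : ℕ) : ℕ := ∑ j ∈ range m, 2 * backDegree j

theorem backDegree_of_lt {j : ℕ} (hj : j < 4) : backDegree j = j := by
  rw [backDegree, if_pos hj]

theorem four_le_two_pow {i : ℕ} (hi : 2 ≤ i) : 4 ≤ 2 ^ i :=
  Nat.pow_le_pow_right (n := 2) (by norm_num) hi

theorem backDegree_two_pow_add {i j : ℕ} (hi : 2 ≤ i) (hj : j < 2 ^ i) :
    backDegree (2 ^ i + j) = 1 + backDegree j := by
  have h4 := four_le_two_pow hi
  have hlog : Nat.log 2 (2 ^ i + j) = i :=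
    Nat.log_eq_of_pow_le_of_lt_pow (by omega) (by rw [pow_succ]; omega)
  rw [backDegree, if_neg (by omega), hlog, Nat.add_sub_cancel_left]

theorem maxDegreeSum_zero : maxDegreeSum 0 = 0 := by simp [maxDegreeSum]

theorem maxDegreeSum_one : maxDegreeSum 1 = 0 := by
  simp [maxDegreeSum, backDegree_of_lt]

theorem maxDegreeSum_two : maxDegreeSum 2 = 2 := by
  simp [maxDegreeSum, sum_range_succ, backDegree_of_lt]

theorem maxDegreeSum_three : maxDegreeSum 3 = 6 := by
  simp [maxDegreeSum, sum_range_succ, backDegree_of_lt]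

theorem maxDegreeSum_four : maxDegreeSum 4 = 12 := by
  simp [maxDegreeSum, sum_range_succ, backDegree_of_lt]

/-- Past the first 2^i vertices the order repeats in a second subcube, each vertex gaining one
matched neighbour. This fails for i = 1, inside K₄. -/
theorem maxDegreeSum_two_pow_add {i j : ℕ} (hi : 2 ≤ i) (hj : j ≤ 2 ^ i) :
    maxDegreeSum (2 ^ i + j) = maxDegreeSum (2 ^ i) + maxDegreeSum j + 2 * j := by
  have h : ∑ l ∈ range j, 2 * backDegree (2 ^ i + l) = ∑ l ∈ range j, (2 * backDegree l + 2) := by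
    refine sum_congr rfl fun l hl => ?_
    rw [backDegree_two_pow_add hi ((mem_range.1 hl).trans_le hj)]
    ring
  rw [maxDegreeSum, sum_range_add, h, sum_add_distrib, sum_const, card_range, smul_eq_mul,
    maxDegreeSum, maxDegreeSum]
  ring

theorem maxDegreeSum_two_pow {i : ℕ} (hi : 2 ≤ i) : maxDegreeSum (2 ^ i) = (i + 1) * 2 ^ i := by
  induction i, hi using Nat.le_induction with
  | base => simpa using maxDegreeSum_four
  | succ i hi ih =>
    rw [pow_succ, mul_two, maxDegreeSum_two_pow_add hi le_rfl, ih]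
    ring

theorem maxDegreeSum_le {i b : ℕ} (hb : b ≤ 2 ^ i) : maxDegreeSum b ≤ (i + 1) * b := by
  induction i generalizing b with
  | zero =>
    have : b ≤ 1 := by simpa using hb
    interval_cases b <;> simp [maxDegreeSum_zero, maxDegreeSum_one]
  | succ i ih =>
    rcases le_or_gt b (2 ^ i) with h | h
    · exact (ih h).trans (Nat.mul_le_mul_right _ (by omega))
    · obtain ⟨c, rfl⟩ := Nat.exists_eq_add_of_lt h
      have hc : c + 1 ≤ 2 ^ i := by rw [pow_succ] at hb; omega
      rcases lt_or_ge i 2 with hi | hi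
      · interval_cases i
        · have : c = 0 := by simpa using hc
          subst this
          simp [maxDegreeSum_two]
        · have : c ≤ 1 := by simpa using hc
          interval_cases c <;> simp [maxDegreeSum_three, maxDegreeSum_four]
      · rw [add_assoc, maxDegreeSum_two_pow_add hi hc, maxDegreeSum_two_pow hi]
        have := ih hc
        nlinarith

/-- Reflection: in an (i+1)-regular graph on 2^i vertices a set and its complement have the same
boundary, so (i+1)x − E(x) is unchanged under x ↦ 2^i − x. -/
theorem maxDegreeSum_two_pow_sub {i x : ℕ} (hi : 2 ≤ i) (hx : x ≤ 2 ^ i) :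
    maxDegreeSum (2 ^ i - x) + 2 * (i + 1) * x = (i + 1) * 2 ^ i + maxDegreeSum x := by
  induction i, hi using Nat.le_induction generalizing x with
  | base =>
    have : x ≤ 4 := by simpa using hx
    interval_cases x <;> simp [maxDegreeSum_zero, maxDegreeSum_one, maxDegreeSum_two,
      maxDegreeSum_three, maxDegreeSum_four]
  | succ i hi ih =>
    have key : ∀ y ≤ 2 ^ i, maxDegreeSum (2 ^ (i + 1) - y) + 2 * (i + 1 + 1) * y =
        (i + 1 + 1) * 2 ^ (i + 1) + maxDegreeSum y := by
      intro y hy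
      obtain ⟨z, hz⟩ := Nat.exists_eq_add_of_le hy
      have h := ih hy
      have e₁ : 2 ^ i - y = z := by omega
      have e₂ : 2 ^ (i + 1) - y = 2 ^ i + z := by rw [pow_succ]; omega
      rw [e₂, maxDegreeSum_two_pow_add hi (by omega), maxDegreeSum_two_pow hi]
      rw [e₁] at h
      rw [pow_succ]
      linarith
    rcases le_or_gt x (2 ^ i) with h | h
    · exact key x h
    · have h' := key (2 ^ (i + 1) - x) (by rw [pow_succ] at hx ⊢; omega)
      rw [Nat.sub_sub_self hx] at h'
      obtain ⟨z, hz⟩ := Nat.exists_eq_add_of_le hx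
      have e : 2 ^ (i + 1) - x = z := by omega
      rw [e] at h' ⊢
      rw [hz] at h' ⊢
      linarith

theorem maxDegreeSum_superadditive (a b : ℕ) (hba : b ≤ a) :
    maxDegreeSum a + maxDegreeSum b + 2 * b ≤ maxDegreeSum (a + b) := by
  induction hs : a + b using Nat.strong_induction_on generalizing a b with
  | _ s ih =>
  subst hs
  have ih' : ∀ c d, c + d < a + b →
      maxDegreeSum c + maxDegreeSum d + 2 * min c d ≤ maxDegreeSum (c + d) := by
    intro c d hcd
    rcases le_total c d with h | h
    · rw [min_eq_left h]
      have := ih (d + c) (by omega) d c h rfl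
      rw [add_comm c d]
      omega
    · rw [min_eq_right h]
      exact ih (c + d) hcd c d h rfl
  rcases lt_or_ge (a + b) 4 with hlt | hge
  · have hb : b ≤ 1 := by omega
    have ha : a ≤ 3 := by omega
    interval_cases b <;> interval_cases a <;>
      simp_all [maxDegreeSum_zero, maxDegreeSum_one, maxDegreeSum_two, maxDegreeSum_three]
  obtain ⟨i, hi⟩ : ∃ i, i = Nat.log 2 (a + b) := ⟨_, rfl⟩
  have hlow : 2 ^ i ≤ a + b := hi ▸ Nat.pow_log_le_self 2 (by omega)
  have hup : a + b < 2 ^ (i + 1) := hi ▸ Nat.lt_pow_succ_log_self (by norm_num) _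
  have hi2 : 2 ≤ i := by
    by_contra! h
    have := Nat.pow_le_pow_right (n := 2) (by norm_num) (show i + 1 ≤ 2 by omega)
    omega
  have hpos : 4 ≤ 2 ^ i := four_le_two_pow hi2
  have hpow := maxDegreeSum_two_pow hi2
  rw [pow_succ] at hup
  -- If a ≥ 2^i, a full subcube is stripped from both a and a + b.
  rcases le_or_gt (2 ^ i) a with ha | ha
  · obtain ⟨c, rfl⟩ := Nat.exists_eq_add_of_le ha
    have h := ih' c b (by omega)
    rw [maxDegreeSum_two_pow_add hi2 (by omega), add_assoc (2 ^ i),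
      maxDegreeSum_two_pow_add hi2 (by omega)]
    omega
  rcases hlow.eq_or_lt with heq | hlt
  -- Here a = 2^i − b, and reflection reduces the claim to E(b) ≤ i·b, which holds because b ≤
  -- 2^(i−1).
  · have hb := maxDegreeSum_two_pow_sub hi2 (show b ≤ 2 ^ i by omega)
    have e : 2 ^ i - b = a := by omega
    obtain ⟨l, rfl⟩ : ∃ l, i = l + 1 := ⟨i - 1, by omega⟩
    have hle : maxDegreeSum b ≤ (l + 1) * b := maxDegreeSum_le (by rw [pow_succ] at *; omega)
    rw [e] at hb
    rw [← heq, hpow]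
    nlinarith
  -- Now a and b are at most 2^i but their sum exceeds it. The complements x and y have smaller sum,
  -- so induction applies to them, and reflecting x, y and x + y carries the result back.
  · obtain ⟨x, hx⟩ := Nat.exists_eq_add_of_le ha.le
    obtain ⟨y, hy⟩ := Nat.exists_eq_add_of_le (show b ≤ 2 ^ i by omega)
    have h := ih' x y (by omega)
    rw [min_eq_left (by omega)] at h
    have hxs := maxDegreeSum_two_pow_sub hi2 (show x ≤ 2 ^ i by omega)
    have hys := maxDegreeSum_two_pow_sub hi2 (show y ≤ 2 ^ i by omega)
    have hxys := maxDegreeSum_two_pow_sub hi2 (show x + y ≤ 2 ^ i by omega)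
    obtain ⟨z, hz⟩ := Nat.exists_eq_add_of_le (show x + y ≤ 2 ^ i by omega)
    rw [show 2 ^ i - x = a by omega] at hxs
    rw [show 2 ^ i - y = b by omega] at hys
    rw [show 2 ^ i - (x + y) = z by omega] at hxys
    have e : a + b = 2 ^ i + z := by omega
    rw [e, maxDegreeSum_two_pow_add hi2 (by omega), hpow]
    have e' : b = x + z := by omega
    nlinarith

theorem maxDegreeSum_add_le (a b : ℕ) :
    maxDegreeSum a + maxDegreeSum b + 2 * min a b ≤ maxDegreeSum (a + b) := by
  rcases le_total a b with h | h
  · have := maxDegreeSum_superadditive b a h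
    rw [min_eq_left h, add_comm a b]
    omega
  · rw [min_eq_right h]
    exact maxDegreeSum_superadditive a b h

/-- The hypothesis says j ≤ ⌈2^(r+1)/3⌉. Removing 2^(r−1) from j turns this condition into the same
one for r − 2, and the 2c extra degrees account for the drop from r to r − 2. -/
theorem maxDegreeSum_le_mul_of_three_mul_le {r j : ℕ} (hj : 3 * j ≤ 2 ^ (r + 1) + 2) :
    maxDegreeSum j ≤ r * j := by
  induction r using Nat.strong_induction_on generalizing j with
  | _ r ih =>
  rcases lt_or_ge r 3 with hr | hr
  · interval_cases r
    · have : j ≤ 1 := by norm_num at hj; omega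
      interval_cases j <;> simp [maxDegreeSum_zero, maxDegreeSum_one]
    · have : j ≤ 2 := by norm_num at hj; omega
      interval_cases j <;> simp [maxDegreeSum_zero, maxDegreeSum_one, maxDegreeSum_two]
    · have : j ≤ 3 := by norm_num at hj; omega
      interval_cases j <;>
        simp [maxDegreeSum_zero, maxDegreeSum_one, maxDegreeSum_two, maxDegreeSum_three]
  · obtain ⟨q, rfl⟩ : ∃ q, r = q + 2 := ⟨r - 2, by omega⟩
    rcases le_or_gt j (2 ^ (q + 1)) with h | h
    · exact maxDegreeSum_le h
    · obtain ⟨c, rfl⟩ := Nat.exists_eq_add_of_le h.le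
      have hq : 2 ^ (q + 2 + 1) = 4 * 2 ^ (q + 1) := by ring
      have h4 := four_le_two_pow (show 2 ≤ q + 1 by omega)
      have hc := ih q (by omega) (j := c) (by omega)
      rw [maxDegreeSum_two_pow_add (by omega) (by omega), maxDegreeSum_two_pow (by omega)]
      nlinarith

/-! ### Numerical lower bound for boundaries -/

theorem mul_two_pow_add_maxDegreeSum_le_of_two_pow_le {k d m : ℕ} (hk : 2 ≤ k) (h₁ : 2 ^ k ≤ m)
    (h₂ : m ≤ 2 ^ (k + d)) : (d + 1) * 2 ^ k + maxDegreeSum m ≤ (k + d + 2) * m := by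
  induction d generalizing m with
  | zero =>
    have : m = 2 ^ k := le_antisymm h₂ h₁
    subst this
    rw [maxDegreeSum_two_pow hk]
    nlinarith
  | succ d ih =>
    rcases le_or_gt m (2 ^ (k + d)) with h | h
    · have := ih h₁ h
      nlinarith
    -- For m above half of 2^(k+d+1), reflect to c = 2^(k+d+1) − m. Induction handles c ≥ 2^k; for
    -- smaller c, E(c) ≤ (k+1)c and d + 2 ≤ 2^(d+1) suffice.
    · have hk' : 2 ≤ k + (d + 1) := by omega
      obtain ⟨c, hc⟩ := Nat.exists_eq_add_of_le h₂
      have hs := maxDegreeSum_two_pow_sub hk' (show c ≤ 2 ^ (k + (d + 1)) by omega)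
      rw [show 2 ^ (k + (d + 1)) - c = m by omega] at hs
      have hle : c ≤ 2 ^ (k + d) := by
        have : 2 ^ (k + (d + 1)) = 2 * 2 ^ (k + d) := by ring
        omega
      rcases le_or_gt (2 ^ k) c with h' | h'
      · have := ih h' hle
        rw [hc] at hs
        nlinarith
      · have hm := maxDegreeSum_le h'.le
        have hd : d + 2 ≤ 2 ^ (d + 1) := Nat.lt_two_pow_self (n := d + 1)
        have hp : 2 ^ (k + (d + 1)) = 2 ^ k * 2 ^ (d + 1) := by ring
        have hkd : (d + 2) * 2 ^ k ≤ 2 ^ (k + (d + 1)) := by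
          rw [hp, mul_comm]; exact Nat.mul_le_mul_left _ hd
        rw [hc] at hs hkd
        nlinarith

/-- The lower bound for the size of an edge boundary, where the number of vertices may be slightly
smaller than a power of two. -/
theorem mul_two_pow_add_maxDegreeSum_le {k d m : ℕ} (hk : 2 ≤ k) (hd : d + 1 ≤ k)
    (h₁ : 3 * 2 ^ k ≤ 3 * m + 2 ^ (k - d + 1) + 2) (h₂ : m ≤ 2 ^ (k + d)) :
    (d + 1) * 2 ^ k + maxDegreeSum m ≤ (k + d + 2) * m := by
  rcases le_or_gt (2 ^ k) m with h | h
  · exact mul_two_pow_add_maxDegreeSum_le_of_two_pow_le hk h h₂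
  · obtain ⟨j, hj⟩ := Nat.exists_eq_add_of_le h.le
    obtain ⟨r, rfl⟩ := Nat.exists_eq_add_of_le (show d ≤ k by omega)
    rw [Nat.add_sub_cancel_left] at h₁
    -- Reflecting m = 2^k − j reduces the goal to E(j) ≤ (k − d)j; this is where the threshold g_t
    -- comes from.
    have hE := maxDegreeSum_le_mul_of_three_mul_le (r := r) (j := j) (by omega)
    have hs := maxDegreeSum_two_pow_sub hk (show j ≤ 2 ^ (d + r) by omega)
    rw [show 2 ^ (d + r) - j = m by omega] at hs
    rw [hj] at hs ⊢
    nlinarith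

/-! ### Cuts in matching joins -/

section MatchingJoin

variable {V₀ V₁ : Type u} (G₀ : SimpleGraph V₀) (G₁ : SimpleGraph V₁) (M : V₀ ≃ V₁)

@[simp]
theorem matchingJoin_adj_inl_inl (a b : V₀) :
    (matchingJoin G₀ G₁ M).Adj (Sum.inl a) (Sum.inl b) ↔ G₀.Adj a b := by
  simp [matchingJoin]

@[simp]
theorem matchingJoin_adj_inr_inr (a b : V₁) :
    (matchingJoin G₀ G₁ M).Adj (Sum.inr a) (Sum.inr b) ↔ G₁.Adj a b := by
  simp [matchingJoin]

@[simp]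
theorem matchingJoin_adj_inl_inr (a : V₀) (b : V₁) :
    (matchingJoin G₀ G₁ M).Adj (Sum.inl a) (Sum.inr b) ↔ b = M a := by
  simp [matchingJoin]

@[simp]
theorem matchingJoin_adj_inr_inl (b : V₁) (a : V₀) :
    (matchingJoin G₀ G₁ M).Adj (Sum.inr b) (Sum.inl a) ↔ b = M a := by
  simp [matchingJoin]

end MatchingJoin

theorem ncard_preimage_iso {V : Type u} {W : Type v} {G : SimpleGraph V} {H : SimpleGraph W}
    (e : G ≃g H) (Y : Set W) :
    (e ⁻¹' Y).ncard = Y.ncard :=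
  Set.ncard_preimage_of_injective_subset_range e.injective (by simp [e.surjective.range_eq])

section CutSize

variable {V : Type u} {W : Type v} [Fintype V] [Fintype W]

open Classical in
/-- The number of edges with exactly one endpoint in `X`. -/
noncomputable def cutSize (G : SimpleGraph V) (X : Set V) : ℕ :=
  ∑ x, ∑ y, if x ∈ X ∧ y ∉ X ∧ G.Adj x y then 1 else 0

theorem encard_edgeBoundary (G : SimpleGraph V) (X : Set V) :
    (edgeBoundary G X).encard = (cutSize G X : ℕ∞) := by
  classical
  have himg : edgeBoundary G X = (fun p : V × V => s(p.1, p.2)) ''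
      ((univ.filter fun p : V × V => p.1 ∈ X ∧ p.2 ∉ X ∧ G.Adj p.1 p.2 : Finset (V × V)) :
        Set (V × V)) := by
    ext e
    simp only [edgeBoundary, Set.mem_ofPred_eq, Set.mem_image, coe_filter, mem_univ, true_and,
      Prod.exists]
    constructor
    · rintro ⟨he, x, hx, y, hy, rfl⟩
      exact ⟨x, y, ⟨hx, hy, he⟩, rfl⟩
    · rintro ⟨x, y, ⟨hx, hy, h⟩, rfl⟩
      exact ⟨h, x, hx, y, hy, rfl⟩
  rw [himg, Set.InjOn.encard_image, Set.encard_coe_eq_coe_finsetCard, card_filter,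
    Fintype.sum_prod_type, cutSize]
  rintro ⟨a, b⟩ h ⟨c, d⟩ h' hs
  simp only [coe_filter, mem_univ, true_and, Set.mem_ofPred_eq] at h h'
  simp only [Sym2.eq_iff] at hs
  rcases hs with ⟨rfl, rfl⟩ | ⟨rfl, rfl⟩
  · rfl
  · exact absurd h'.1 h.2.1

open Classical in
theorem ncard_eq_sum_ite (X : Set V) : X.ncard = ∑ x, if x ∈ X then 1 else 0 := by
  rw [← card_filter, ← Set.ncard_coe_finset]
  simp

theorem cutSize_preimage {G : SimpleGraph V} {H : SimpleGraph W} (e : G ≃g H) (Y : Set W) :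
    cutSize G (e ⁻¹' Y) = cutSize H Y := by
  classical
  rw [cutSize, cutSize, ← Equiv.sum_comp e.toEquiv]
  refine sum_congr rfl fun x _ => ?_
  rw [← Equiv.sum_comp e.toEquiv]
  simp [e.map_adj_iff]

open Classical in
theorem cutSize_matchingJoin {V W : Type u} [Fintype V] [Fintype W] (G₀ : SimpleGraph V) (G₁ : SimpleGraph W) (M : V ≃ W)
    (X : Set (V ⊕ W)) :
    cutSize (matchingJoin G₀ G₁ M) X =
      cutSize G₀ (Sum.inl ⁻¹' X) + cutSize G₁ (Sum.inr ⁻¹' X) +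
        ((∑ x, if Sum.inl x ∈ X ∧ Sum.inr (M x) ∉ X then 1 else 0) +
          ∑ x, if Sum.inr (M x) ∈ X ∧ Sum.inl x ∉ X then 1 else 0) := by
  have h₁ : ∀ x, (∑ y, if Sum.inl x ∈ X ∧ Sum.inr y ∉ X ∧ y = M x then 1 else 0) =
      if Sum.inl x ∈ X ∧ Sum.inr (M x) ∉ X then 1 else 0 := by
    intro x
    rw [sum_eq_single (M x)] <;> simp +contextual
  have h₂ : ∀ x, (∑ y, if Sum.inr (M x) ∈ X ∧ Sum.inl y ∉ X ∧ M x = M y then 1 else 0) =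
      if Sum.inr (M x) ∈ X ∧ Sum.inl x ∉ X then 1 else 0 := by
    intro x
    rw [sum_eq_single x]
    · simp
    · intro y _ hy
      simp [hy.symm]
    · simp
  simp only [cutSize, Fintype.sum_sum_type, matchingJoin_adj_inl_inl, matchingJoin_adj_inr_inr,
    matchingJoin_adj_inl_inr, matchingJoin_adj_inr_inl, sum_add_distrib, h₁, Set.mem_preimage]
  rw [← Equiv.sum_comp M
    (fun x => ∑ y, if Sum.inr x ∈ X ∧ Sum.inl y ∉ X ∧ x = M y then 1 else 0)]
  simp only [h₂]
  ring

theorem ncard_preimage_inl_add_inr (X : Set (V ⊕ W)) :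
    X.ncard = (Sum.inl ⁻¹' X : Set V).ncard + (Sum.inr ⁻¹' X : Set W).ncard := by
  classical
  simp only [ncard_eq_sum_ite, Fintype.sum_sum_type, Set.mem_preimage]

/-- c₀ and c₁ count the matching edges leaving X from the left and from the right; vertices whose
partner is also in X cancel in the comparison. -/
theorem exists_cutSize_matchingJoin_eq {V W : Type u} [Fintype V] [Fintype W]
    (G₀ : SimpleGraph V) (G₁ : SimpleGraph W) (M : V ≃ W) (X : Set (V ⊕ W)) :
    ∃ c₀ c₁ : ℕ, cutSize (matchingJoin G₀ G₁ M) X =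
        cutSize G₀ (Sum.inl ⁻¹' X) + cutSize G₁ (Sum.inr ⁻¹' X) + (c₀ + c₁) ∧
      (Sum.inl ⁻¹' X : Set V).ncard ≤ (Sum.inr ⁻¹' X : Set W).ncard + c₀ ∧
      (Sum.inr ⁻¹' X : Set W).ncard ≤ (Sum.inl ⁻¹' X : Set V).ncard + c₁ := by
  classical
  refine ⟨_, _, cutSize_matchingJoin G₀ G₁ M X, ?_, ?_⟩ <;>
  · rw [ncard_eq_sum_ite, ncard_eq_sum_ite, ← Equiv.sum_comp M, ← sum_add_distrib]
    refine sum_le_sum fun x _ => ?_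
    by_cases hx : Sum.inl x ∈ X <;> by_cases hy : Sum.inr (M x) ∈ X <;> simp [hx, hy]

end CutSize

/-! ### Structure and isoperimetry of K₄-hypercubes -/

theorem IsK4Hypercube.finite {n : ℕ} {V : Type u} {G : SimpleGraph V} (h : IsK4Hypercube n G) :
    Finite V := by
  induction h with
  | base G e => exact Finite.of_equiv _ e.toEquiv.symm
  | step _ _ _ _ _ _ e ih₀ ih₁ => exact Finite.of_equiv _ e.toEquiv.symm

theorem IsK4Hypercube.card {n : ℕ} {V : Type u} {G : SimpleGraph V} (h : IsK4Hypercube n G) :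
    Nat.card V = 2 ^ n := by
  induction h with
  | base G e => simp [Nat.card_congr e.toEquiv]
  | step G₀ G₁ h₀ h₁ M G e ih₀ ih₁ =>
    have := h₀.finite
    have := h₁.finite
    rw [Nat.card_congr e.toEquiv, Nat.card_sum, ih₀, ih₁]
    ring

theorem IsK4Hypercube.connected {n : ℕ} {V : Type u} {G : SimpleGraph V}
    (h : IsK4Hypercube n G) : G.Connected := by
  induction h with
  | base G e => exact e.connected_iff.2 SimpleGraph.connected_top
  | step G₀ G₁ h₀ h₁ M G e ih₀ ih₁ =>
    rw [e.connected_iff, SimpleGraph.connected_iff_exists_forall_reachable]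
    obtain ⟨v⟩ := ih₁.nonempty
    have hr : ∀ w, (matchingJoin G₀ G₁ M).Reachable (Sum.inr v) (Sum.inr w) := fun w =>
      (ih₁.preconnected v w).map ⟨Sum.inr, fun {a b} h => by simpa using h⟩
    refine ⟨Sum.inr v, ?_⟩
    rintro (w | w)
    · exact (hr (M w)).trans (SimpleGraph.Adj.reachable (by simp))
    · exact hr w

theorem IsK4Hypercube.le_cutSize_add {n : ℕ} {V : Type u} {G : SimpleGraph V}
    (h : IsK4Hypercube n G) :
    ∀ [Fintype V] (X : Set V), (n + 1) * X.ncard ≤ cutSize G X + maxDegreeSum X.ncard := by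
  induction h with
  | base G e =>
    intro _ X
    classical
    rw [← cutSize_preimage e.symm X, ← ncard_preimage_iso e.symm X]
    generalize e.symm ⁻¹' X = Y
    have hY : Y.ncard + (Yᶜ).ncard = 4 := by
      rw [Set.ncard_add_ncard_compl]; simp
    have hcut : cutSize (⊤ : SimpleGraph (Fin 4)) Y = Y.ncard * (Yᶜ).ncard := by
      rw [ncard_eq_sum_ite, ncard_eq_sum_ite, sum_mul_sum, cutSize]
      refine sum_congr rfl fun x _ => sum_congr rfl fun y _ => ?_
      by_cases hx : x ∈ Y <;> by_cases hy : y ∈ Y <;> simp [hx, hy]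
      rintro rfl
      exact hy hx
    rw [hcut]
    generalize Y.ncard = a at *
    generalize (Yᶜ).ncard = b at *
    obtain rfl : b = 4 - a := by omega
    have : a ≤ 4 := by omega
    interval_cases a <;> simp [maxDegreeSum_three, maxDegreeSum_four, maxDegreeSum_two]
  | @step n V V₀ V₁ G₀ G₁ h₀ h₁ M G e ih₀ ih₁ =>
    classical
    intro _ X
    have := h₀.finite
    have := h₁.finite
    have := Fintype.ofFinite V₀
    have := Fintype.ofFinite V₁
    rw [← cutSize_preimage e.symm X, ← ncard_preimage_iso e.symm X]
    generalize e.symm ⁻¹' X = Y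
    rw [ncard_preimage_inl_add_inr]
    have hY₀ := ih₀ (Sum.inl ⁻¹' Y)
    have hY₁ := ih₁ (Sum.inr ⁻¹' Y)
    have hs := maxDegreeSum_add_le (Sum.inl ⁻¹' Y : Set _).ncard (Sum.inr ⁻¹' Y : Set _).ncard
    obtain ⟨c₀, c₁, hcut, hc₀, hc₁⟩ := exists_cutSize_matchingJoin_eq G₀ G₁ M Y
    rw [hcut]
    generalize (Sum.inl ⁻¹' Y : Set _).ncard = a at *
    generalize (Sum.inr ⁻¹' Y : Set _).ncard = b at *
    -- Passing from n to n + 1 costs a + b, which is covered by 2 min(a,b) from superadditivity and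
    -- |a − b| ≤ c₀ + c₁.
    rcases le_total a b with h | h
    · rw [min_eq_left h] at hs
      nlinarith
    · rw [min_eq_right h] at hs
      nlinarith

/-- Isomorphic graphs have isomorphic induced subgraphs. -/
def inducePreimageIso {V W : Type u} {G : SimpleGraph V} {H : SimpleGraph W} (e : G ≃g H)
    (Y : Set W) : G.induce (e ⁻¹' Y) ≃g H.induce Y where
  toEquiv := e.toEquiv.subtypeEquiv fun _ => Iff.rfl
  map_rel_iff' := by simp [e.map_adj_iff]

/-- Always descend into the left half. The complement is connected because it contains the whole
right half, to which every remaining left vertex is matched. For k = n it is empty, hence the guard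
k < n. -/
theorem IsK4Hypercube.exists_subcube {n k : ℕ} {V : Type u} {G : SimpleGraph V}
    (h : IsK4Hypercube n G) (hk : 2 ≤ k) (hkn : k ≤ n) :
    ∀ [Fintype V], ∃ X : Set V, X.ncard = 2 ^ k ∧ (G.induce X).Connected ∧
      (k < n → (G.induce Xᶜ).Connected) ∧ cutSize G X = (n - k) * 2 ^ k := by
  have huniv : ∀ {n : ℕ} {V : Type u} {G : SimpleGraph V}, IsK4Hypercube n G → k = n →
      ∀ [Fintype V], ∃ X : Set V, X.ncard = 2 ^ k ∧ (G.induce X).Connected ∧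
      (k < n → (G.induce Xᶜ).Connected) ∧ cutSize G X = (n - k) * 2 ^ k := by
    rintro n V G h rfl _
    refine ⟨Set.univ, by rw [Set.ncard_univ, h.card], ?_, fun h => absurd h (lt_irrefl _), ?_⟩
    · exact (SimpleGraph.induceUnivIso G).connected_iff.2 h.connected
    · simp [cutSize]
  induction h with
  | base G e =>
    intro _
    exact huniv (.base G e) (by omega)
  | @step n V V₀ V₁ G₀ G₁ h₀ h₁ M G e ih₀ ih₁ =>
    intro _
    rcases hkn.eq_or_lt with heq | hlt
    · exact huniv (.step G₀ G₁ h₀ h₁ M G e) heq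
    classical
    have := h₀.finite
    have := h₁.finite
    have := Fintype.ofFinite V₀
    have := Fintype.ofFinite V₁
    obtain ⟨X, hcard, hconn, -, hcut⟩ := ih₀ (by omega)
    let Y : Set (V₀ ⊕ V₁) := Sum.inl '' X
    have hl : Sum.inl ⁻¹' Y = X := Set.preimage_image_eq _ Sum.inl_injective
    have hr : Sum.inr ⁻¹' Y = (∅ : Set V₁) := by ext; simp [Y]
    refine ⟨e ⁻¹' Y, ?_, ?_, fun _ => ?_, ?_⟩
    · rw [ncard_preimage_iso, ncard_preimage_inl_add_inr, hl, hr, hcard, Set.ncard_empty, add_zero]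
    · rw [(inducePreimageIso e Y).connected_iff]
      refine hconn.map ⟨fun x => ⟨Sum.inl x.1, x.1, x.2, rfl⟩, fun {a b} h => ?_⟩ ?_
      · simpa using h
      · rintro ⟨_, x, hx, rfl⟩
        exact ⟨⟨x, hx⟩, rfl⟩
    · rw [← Set.preimage_compl, (inducePreimageIso e Yᶜ).connected_iff,
        SimpleGraph.connected_iff_exists_forall_reachable]
      have hmem : ∀ w, Sum.inr w ∈ Yᶜ := fun w => by simp [Y]
      obtain ⟨v⟩ := h₁.connected.nonempty
      let f : G₁ →g (matchingJoin G₀ G₁ M).induce Yᶜ :=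
        ⟨fun w => ⟨Sum.inr w, hmem w⟩, fun {a b} h => by simpa using h⟩
      have hreach : ∀ w, ((matchingJoin G₀ G₁ M).induce Yᶜ).Reachable
          ⟨Sum.inr v, hmem v⟩ ⟨Sum.inr w, hmem w⟩ := fun w =>
        (h₁.connected.preconnected v w).map f
      refine ⟨⟨Sum.inr v, hmem v⟩, ?_⟩
      rintro ⟨w | w, hw⟩
      · exact (hreach (M w)).trans (SimpleGraph.Adj.reachable (by simp))
      · exact hreach w
    · rw [cutSize_preimage, cutSize_matchingJoin, hl, hr, hcut]
      -- Every vertex of the subcube sends its matching edge out of it, so each dimension adds 2^k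
      -- to the boundary.
      have h₁ : (∑ x, if Sum.inl x ∈ Y ∧ Sum.inr (M x) ∉ Y then 1 else 0) = 2 ^ k := by
        rw [← hcard, ncard_eq_sum_ite]
        simp [Y]
      rw [h₁, Nat.sub_add_comm (by omega)]
      simp [cutSize, Y]
      ring

end

/-! ### Extra edge-cuts versus boundaries of vertex sets -/

theorem edgeBoundary_compl {V : Type u} (G : SimpleGraph V) (X : Set V) :
    edgeBoundary G Xᶜ = edgeBoundary G X := by
  ext e
  constructor
  · rintro ⟨he, x, hx, y, hy, rfl⟩
    exact ⟨he, y, not_not.1 hy, x, hx, Sym2.eq_swap⟩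
  · rintro ⟨he, x, hx, y, hy, rfl⟩
    exact ⟨he, y, hy, x, not_not.2 hx, Sym2.eq_swap⟩

theorem edgeBoundary_supp_subset {V : Type u} (G : SimpleGraph V) (F : Set (Sym2 V))
    (C : (G.deleteEdges F).ConnectedComponent) : edgeBoundary G C.supp ⊆ F := by
  rintro _ ⟨he, x, hx, y, hy, rfl⟩
  by_contra hF
  have hadj : (G.deleteEdges F).Adj x y := by
    rw [SimpleGraph.deleteEdges_adj]
    exact ⟨he, hF⟩
  exact hy ((C.mem_supp_congr_adj hadj).1 hx)

/-- An extra edge-cut contains the boundary of a set of at most half of the vertices, of which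
there are at least `h`. -/
theorem IsExtraEdgeCut.exists_edgeBoundary_subset {V : Type u} [Finite V] [Nonempty V]
    {G : SimpleGraph V} {h : ℕ} {F : Set (Sym2 V)} (hF : IsExtraEdgeCut G h F) :
    ∃ X : Set V, h ≤ X.ncard ∧ X.ncard ≤ Nat.card V / 2 ∧ edgeBoundary G X ⊆ F := by
  obtain ⟨-, hdis, hcomp⟩ := hF
  have hpre : ¬ (G.deleteEdges F).Preconnected := fun hp => hdis ⟨hp⟩
  simp only [SimpleGraph.Preconnected, not_forall] at hpre
  obtain ⟨u, v, huv⟩ := hpre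
  let C := (G.deleteEdges F).connectedComponentMk u
  let D := (G.deleteEdges F).connectedComponentMk v
  have hDC : D.supp ⊆ C.suppᶜ := by
    intro w hw hw'
    exact huv (SimpleGraph.ConnectedComponent.exact
      ((hw' : _ = C).symm.trans (hw : _ = D)))
  have hsum := Set.ncard_add_ncard_compl C.supp
  rcases le_or_gt C.supp.ncard (Nat.card V / 2) with hC | hC
  · exact ⟨C.supp, hcomp C, hC, edgeBoundary_supp_subset G F C⟩
  -- The complement of a large component still has at least h vertices, since it contains the
  -- component D.
  · refine ⟨C.suppᶜ, (hcomp D).trans (Set.ncard_le_ncard hDC), by omega, ?_⟩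
    rw [edgeBoundary_compl]
    exact edgeBoundary_supp_subset G F C

/-- The boundary of a set `X` such that `X` and its complement induce connected subgraphs is an
extra edge-cut. -/
theorem isExtraEdgeCut_edgeBoundary {V : Type u} [Finite V] {G : SimpleGraph V} {h : ℕ} {X : Set V}
    (hX : (G.induce X).Connected) (hX' : (G.induce Xᶜ).Connected) (hh : h ≤ X.ncard)
    (hh' : h ≤ (Xᶜ).ncard) : IsExtraEdgeCut G h (edgeBoundary G X) := by
  have hadj : ∀ a b, (G.deleteEdges (edgeBoundary G X)).Adj a b ↔ G.Adj a b ∧ (a ∈ X ↔ b ∈ X) := by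
    intro a b
    rw [SimpleGraph.deleteEdges_adj]
    refine and_congr_right fun hab => ?_
    constructor
    · intro hn
      by_contra hne
      refine hn ?_
      by_cases ha : a ∈ X
      · exact ⟨hab, a, ha, b, by tauto, rfl⟩
      · exact ⟨hab, b, by tauto, a, ha, Sym2.eq_swap⟩
    · rintro hiff ⟨-, x, hx, y, hy, hs⟩
      rcases Sym2.eq_iff.1 hs with ⟨rfl, rfl⟩ | ⟨rfl, rfl⟩ <;> tauto
  have hreach : ∀ a b, (G.deleteEdges (edgeBoundary G X)).Reachable a b → (a ∈ X ↔ b ∈ X) := by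
    rintro a b ⟨p⟩
    induction p with
    | nil => rfl
    | cons hab _ ih => exact ((hadj _ _).1 hab).2.trans ih
  have hin : ∀ a ∈ X, ∀ b ∈ X, (G.deleteEdges (edgeBoundary G X)).Reachable a b :=
    fun a ha b hb => (hX.preconnected ⟨a, ha⟩ ⟨b, hb⟩).map
      ⟨Subtype.val, fun {c d} hcd => (hadj _ _).2 ⟨hcd, iff_of_true c.2 d.2⟩⟩
  have hout : ∀ a ∈ Xᶜ, ∀ b ∈ Xᶜ, (G.deleteEdges (edgeBoundary G X)).Reachable a b :=
    fun a ha b hb => (hX'.preconnected ⟨a, ha⟩ ⟨b, hb⟩).map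
      ⟨Subtype.val, fun {c d} hcd => (hadj _ _).2 ⟨hcd, iff_of_false c.2 d.2⟩⟩
  refine ⟨fun e he => he.1, fun hc => ?_, fun C => ?_⟩
  · obtain ⟨x⟩ := hX.nonempty
    obtain ⟨y⟩ := hX'.nonempty
    exact y.2 ((hreach _ _ (hc.preconnected x.1 y.1)).1 x.2)
  · induction C using SimpleGraph.ConnectedComponent.ind with
    | _ v =>
    by_cases hv : v ∈ X
    · exact hh.trans (Set.ncard_le_ncard fun a ha =>
        SimpleGraph.ConnectedComponent.sound (hin a ha v hv))
    · exact hh'.trans (Set.ncard_le_ncard fun a ha =>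
        SimpleGraph.ConnectedComponent.sound (hout a ha v hv))

/-! ### Conclusion -/

theorem IsK4Hypercube.le_encard_edgeBoundary {V : Type u} {G : SimpleGraph V} {k d : ℕ}
    (hG : IsK4Hypercube (k + (d + 1)) G) (hk : 2 ≤ k) (hd : d + 1 ≤ k) {X : Set V}
    (h₁ : 3 * 2 ^ k ≤ 3 * X.ncard + 2 ^ (k - d + 1) + 2) (h₂ : X.ncard ≤ Nat.card V / 2) :
    (((d + 1) * 2 ^ k : ℕ) : ℕ∞) ≤ (edgeBoundary G X).encard := by
  have := hG.finite
  have := Fintype.ofFinite V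
  rw [encard_edgeBoundary, Nat.cast_le]
  have hX := hG.le_cutSize_add X
  have hcard : Nat.card V = 2 * 2 ^ (k + d) := by rw [hG.card]; ring
  have hm := mul_two_pow_add_maxDegreeSum_le hk hd h₁ (by omega)
  have e : k + (d + 1) + 1 = k + d + 2 := by ring
  rw [e] at hX
  omega

theorem theorem2 {V : Type u} [Finite V] (G : SimpleGraph V) (n t h : ℕ)
    (hn : 4 ≤ n) (hG : IsK4Hypercube n G) (ht : t ≤ n / 2 - 1)
    (h_lower : (2 : ℤ) ^ ((n + 1) / 2 + t) - ⌈(2 : ℚ) ^ (2 * t + 2 + n % 2) / 3⌉ ≤ (h : ℤ))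
    (h_upper : h ≤ 2 ^ ((n + 1) / 2 + t)) :
    extraEdgeConnectivity G h = xi G (2 ^ ((n + 1) / 2 + t)) ∧
      xi G (2 ^ ((n + 1) / 2 + t)) = (((n / 2 - t) * 2 ^ ((n + 1) / 2 + t) : ℕ) : ℕ∞) := by
  obtain ⟨k, hk⟩ : ∃ k, k = (n + 1) / 2 + t := ⟨_, rfl⟩
  obtain ⟨d, hd⟩ : ∃ d, n / 2 - t = d + 1 := ⟨n / 2 - t - 1, by omega⟩
  have hnk : n = k + (d + 1) := by omega
  have hexp : 2 * t + 2 + n % 2 = k - d + 1 := by omega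
  rw [hexp, ← hk] at h_lower
  rw [← hk] at h_upper ⊢
  rw [hd]
  have hk2 : 2 ≤ k := by omega
  have hdk : d + 1 ≤ k := by omega
  clear hexp hd hk ht
  subst hnk
  -- Clears the ceiling: ⌈y⌉ < y + 1 gives a strict bound with + 3, which over the integers is ≤
  -- with + 2.
  have hlow : 3 * 2 ^ k ≤ 3 * h + 2 ^ (k - d + 1) + 2 := by
    have h₁ := Int.ceil_lt_add_one ((2 : ℚ) ^ (k - d + 1) / 3)
    have h₂ : ((2 : ℚ) ^ k - ⌈(2 : ℚ) ^ (k - d + 1) / 3⌉) ≤ h := by exact_mod_cast h_lower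
    have h₃ : (3 * 2 ^ k : ℚ) < 3 * h + 2 ^ (k - d + 1) + 3 := by linarith
    have h₄ : 3 * 2 ^ k < 3 * h + 2 ^ (k - d + 1) + 3 := by exact_mod_cast h₃
    omega
  have hcard : Nat.card V = 2 * 2 ^ (k + d) := by rw [hG.card]; ring
  have hle : 2 ^ k ≤ 2 ^ (k + d) := Nat.pow_le_pow_right (by norm_num) (by omega)
  have := Fintype.ofFinite V
  have := hG.connected.nonempty
  obtain ⟨X, hXcard, hX, hX', hcut⟩ := hG.exists_subcube hk2 (by omega)
  specialize hX' (by omega)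
  have hXb : (edgeBoundary G X).encard = (((d + 1) * 2 ^ k : ℕ) : ℕ∞) := by
    rw [encard_edgeBoundary, hcut, Nat.add_sub_cancel_left]
  have hxi : xi G (2 ^ k) = (((d + 1) * 2 ^ k : ℕ) : ℕ∞) := by
    refine le_antisymm ?_ (le_iInf₂ fun Y hY => ?_)
    · rw [← hXb]
      exact iInf₂_le X ⟨hXcard, by omega, hX, hX'⟩
    · exact hG.le_encard_edgeBoundary hk2 hdk (by omega) (hY.1.trans_le hY.2.1)
  refine ⟨?_, hxi⟩
  rw [hxi]
  refine le_antisymm ?_ (le_iInf₂ fun F hF => ?_)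
  · rw [← hXb]
    have hsum := Set.ncard_add_ncard_compl X
    exact iInf₂_le _ (isExtraEdgeCut_edgeBoundary hX hX' (by omega) (by omega))
  · obtain ⟨Y, hY, hY', hYF⟩ := hF.exists_edgeBoundary_subset
    exact (hG.le_encard_edgeBoundary hk2 hdk (by omega) hY').trans (Set.encard_le_encard hYF)
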